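/- For $d\in[0,1]$, the binary i.i.d. deletion channel with deletion probability $d$ takes a string of bits, deletes each bit independently with probability $d$, and delivers the remaining bits in their original order; neither transmitter nor receiver knows the deleted positions. Its capacity, in bits per channel use, is $$C(d)=\lim_{N\to\infty}\frac1N\max_{P_{X}} I(X;Y),$$ where the maximum is over all probability distributions of the input string $X\in\{0,1\}^N$ and $Y$ (a bit string of length at most $N$) is the corresponding output. This limit exists for every $d\in[0,1]$. Theorem. Let $d_1,d_2,\lambda\in[0,1]$ and $d=\lambda d_1+(1-\lambda)d_2$. Then $$C(d)\le \lambda C(d_1)+(1-\lambda)C(d_2)+(1-d)\log_2(1-d)-\lambda(1-d_1)\log_2(\lambda(1-d_1))-(1-\lambda)(1-d_2)\log_2((1-\lambda)(1-d_2)),$$ where $0\log_2 0=0$. -/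

import Mathlib

open Filter Topology

/-- The mutual information `I(X; Y)`, in bits, of a random input `X` with probability mass function
`p` on a finite alphabet and the output `Y` of a channel with finite output alphabet and transition
probabilities `W x y = P(Y = y | X = x)`; terms with `p x * W x y = 0` contribute `0`. -/
noncomputable def mutualInformation {α β : Type*} [Fintype α] [Fintype β]
    (p : α → ℝ) (W : α → β → ℝ) : ℝ :=
  ∑ x, ∑ y, p x * W x y * Real.logb 2 (W x y / ∑ x', p x' * W x' y)

/-- The finite set of possible received words when `N` bits are sent: bit strings of length at most
`N`, including the empty one. -/
abbrev ReceivedWord (N : ℕ) : Type := {y : List Bool // y.length ≤ N}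

noncomputable instance (N : ℕ) : Fintype (ReceivedWord N) :=
  @Fintype.ofFinite _ (List.finite_length_le Bool N).to_subtype

/-- The word received when `x` is sent and exactly the bits at the positions in `K` survive:
the surviving bits, in their original order, without any trace of the deleted positions. -/
def received {N : ℕ} (x : Fin N → Bool) (K : Finset (Fin N)) : ReceivedWord N :=
  ⟨((List.finRange N).filter (fun i => decide (i ∈ K))).map x, by
    rw [List.length_map]
    exact (List.length_filter_le _ _).trans (List.length_finRange).le⟩

/-- The i.i.d. binary deletion channel used on `N` bits: every bit is deleted with probability `d`,
independently of the others. The probability of receiving `y` when `x` is sent is the total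
probability of the sets `K` of surviving positions that turn `x` into `y`. -/
noncomputable def deletionChannel (d : ℝ) (N : ℕ) (x : Fin N → Bool) (y : ReceivedWord N) : ℝ :=
  ∑ K : Finset (Fin N) with received x K = y, (1 - d) ^ K.card * d ^ (N - K.card)

/-- The largest mutual information `I(X; Y)` between `N` input bits and the output of the deletion
channel, over all joint distributions of the input bits. -/
noncomputable def maxInformation (d : ℝ) (N : ℕ) : ℝ :=
  sSup ((fun p : (Fin N → Bool) → ℝ => mutualInformation p (deletionChannel d N)) ''
    stdSimplex ℝ (Fin N → Bool))

/-- The capacity `C(d)`, in bits per channel use, of the i.i.d. deletion channel with deletion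
probability `d`: the limit of the maximal mutual information per input bit. -/
noncomputable def deletionCapacity (d : ℝ) : ℝ :=
  limUnder atTop (fun N : ℕ => maxInformation d N / N)

/-! Send each bit, by an independent coin of bias λ, to one of two deletion channels with parameters
d₁ and d₂. Every bit is then deleted independently with probability d, so merging the two outputs in
the original order gives exactly the channel with parameter d. Let Y₁, Y₂ be the two outputs and F
the word of labels telling which channel delivered each received bit. Since Y is the interleaving of
Y₁ and Y₂ along F, data processing gives I(X;Y) ≤ I(X;Y₁,Y₂,F) ≤ I(X;Y₁,Y₂) + H(F|Y₁,Y₂).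

For the last term, |F| = |Y₁| + |Y₂| is known, so F can be coded as i.i.d. labels with probabilities
r₁, r₂. The Gibbs inequality bounds the cost by N(-a log r₁ - b log r₂), where a = λ(1-d₁) and b =
(1-λ)(1-d₂); taking r₁ = a/(a+b), r₂ = b/(a+b) gives N times the correction term
(`entropy_labels_le`).

For I(X;Y₁,Y₂), reveal the set A of positions sent to the first channel. Given A, two independent
channels act on disjoint blocks, so the information is at most the sum of the two maxima, for
lengths |A| and N - |A| (`noiseInformation_split_le`). Averaging over A gives
`maxInformation_mix_le`; dividing by N and using E|A| = λN gives the theorem. The limits exist by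
Fekete's lemma.

Every channel is written as a deterministic function of the input and an independent finite noise,
so that all entropies live on finite weighted spaces, whatever the output type. -/

open Classical in
/-- The image of a weight function `w` on a finite type under a map `f`. -/
noncomputable def pushforward {Ω S : Type*} [Fintype Ω] (w : Ω → ℝ) (f : Ω → S) (s : S) : ℝ :=
  ∑ ω, if f ω = s then w ω else 0

/-- The entropy, in bits, of the random variable `f` on the finite weighted space `(Ω, w)`. -/
noncomputable def entropy {Ω S : Type*} [Fintype Ω] (w : Ω → ℝ) (f : Ω → S) : ℝ :=
  -∑ ω, w ω * Real.logb 2 (pushforward w f (f ω))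

/-- The product weight on `α × κ`. -/
def prodWeight {α κ : Type*} (p : α → ℝ) (w : κ → ℝ) : α × κ → ℝ := fun z => p z.1 * w z.2

/-- The mutual information of an input with distribution `p` and the output `f x k`, where the
noise `k` has distribution `w` and is independent of the input. -/
noncomputable def noiseInformation {α κ β : Type*} [Fintype α] [Fintype κ]
    (p : α → ℝ) (w : κ → ℝ) (f : α → κ → β) : ℝ :=
  entropy (prodWeight p w) (fun z => f z.1 z.2) - ∑ x, p x * entropy w (f x)

/-! ### Entropy inequalities on finite weighted spaces -/

section Entropy

variable {Ω Ω' S T : Type*} [Fintype Ω] [Fintype Ω'] {w : Ω → ℝ}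

lemma pushforward_nonneg (hw : 0 ≤ w) (f : Ω → S) (s : S) : 0 ≤ pushforward w f s :=
  Finset.sum_nonneg fun ω _ => by split_ifs <;> [exact hw ω; exact le_rfl]

lemma le_pushforward (hw : 0 ≤ w) (f : Ω → S) (ω : Ω) : w ω ≤ pushforward w f (f ω) := by
  classical
  have h := Finset.single_le_sum (f := fun ω' => if f ω' = f ω then w ω' else 0)
    (fun ω' _ => by split_ifs <;> [exact hw ω'; exact le_rfl]) (Finset.mem_univ ω)
  simpa [pushforward] using h

lemma pushforward_le_of_factor (hw : 0 ≤ w) (f : Ω → S) (g : S → T) (ω : Ω) :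
    pushforward w f (f ω) ≤ pushforward w (fun ω => g (f ω)) (g (f ω)) := by
  refine Finset.sum_le_sum fun ω' _ => ?_
  by_cases h : f ω' = f ω
  · simp [h]
  · rw [if_neg h]
    split_ifs <;> [exact hw ω'; exact le_rfl]

lemma sum_pushforward_mul_of_mem (f : Ω → S) (s : Finset S) (hs : ∀ ω, f ω ∈ s) (g : S → ℝ) :
    ∑ y ∈ s, pushforward w f y * g y = ∑ ω, w ω * g (f ω) := by
  classical
  simp only [pushforward, Finset.sum_mul]
  rw [Finset.sum_comm]
  refine Finset.sum_congr rfl fun ω _ => ?_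
  rw [Finset.sum_eq_single (f ω)]
  · simp
  · intro y _ hy
    simp [hy.symm]
  · exact fun h => absurd (hs ω) h

lemma sum_pushforward_mul [Fintype S] (f : Ω → S) (g : S → ℝ) :
    ∑ y, pushforward w f y * g y = ∑ ω, w ω * g (f ω) :=
  sum_pushforward_mul_of_mem f Finset.univ (fun _ => Finset.mem_univ _) g

lemma pushforward_pushforward (π : Ω → Ω') (f : Ω' → S) :
    pushforward (pushforward w π) f = pushforward w (fun ω => f (π ω)) := by
  classical
  funext s
  have := sum_pushforward_mul (w := w) π (fun y => if f y = s then 1 else 0)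
  simpa [pushforward] using this

lemma entropy_pushforward (π : Ω → Ω') (f : Ω' → S) :
    entropy (pushforward w π) f = entropy w (fun ω => f (π ω)) := by
  unfold entropy
  rw [pushforward_pushforward, sum_pushforward_mul]

/-- The conditional Gibbs inequality: if `q` is a conditional sub-distribution of `Z` given `g Z`,
then `H(Z) - H(g Z)` is at most the expectation of `-log₂ q`. -/
lemma entropy_sub_entropy_le (hw : 0 ≤ w) (Z : Ω → S) (g : S → T) (q : S → ℝ) (hq : 0 ≤ q)
    (hpos : ∀ ω, 0 < w ω → 0 < q (Z ω))
    (hsum : ∀ (s : Finset S) (y : T), (∀ z ∈ s, ∃ ω, Z ω = z) → (∀ z ∈ s, g z = y) →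
      ∑ z ∈ s, q z ≤ 1) :
    entropy w Z - entropy w (fun ω => g (Z ω)) ≤ -∑ ω, w ω * Real.logb 2 (q (Z ω)) := by
  classical
  set PZ := pushforward w Z with hPZ
  set PY := pushforward w (fun ω => g (Z ω)) with hPY
  -- The ratio inside the logarithm has expectation at most the total mass, because `q` sums to at
  -- most 1 on each fibre of `g`; `log u ≤ u - 1` then finishes.
  have key : ∑ ω, w ω * (PY (g (Z ω)) * q (Z ω) / PZ (Z ω)) ≤ ∑ ω, w ω := by
    set I := Finset.univ.image Z
    have hI : ∀ ω, Z ω ∈ I := fun ω => Finset.mem_image_of_mem _ (Finset.mem_univ _)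
    have hJ : ∀ ω, g (Z ω) ∈ I.image g := fun ω => Finset.mem_image_of_mem _ (hI ω)
    calc ∑ ω, w ω * (PY (g (Z ω)) * q (Z ω) / PZ (Z ω))
        = ∑ z ∈ I, PZ z * (PY (g z) * q z / PZ z) :=
          (sum_pushforward_mul_of_mem Z I hI (fun z => PY (g z) * q z / PZ z)).symm
      _ ≤ ∑ z ∈ I, PY (g z) * q z := by
          refine Finset.sum_le_sum fun z _ => ?_
          by_cases h : PZ z = 0
          · rw [h, zero_mul]
            exact mul_nonneg (pushforward_nonneg hw _ _) (hq z)
          · rw [mul_div_cancel₀ _ h]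
      _ = ∑ y ∈ I.image g, ∑ z ∈ I with g z = y, PY (g z) * q z :=
          (Finset.sum_fiberwise_of_maps_to (fun z hz => Finset.mem_image_of_mem g hz) _).symm
      _ = ∑ y ∈ I.image g, PY y * ∑ z ∈ I with g z = y, q z := by
          refine Finset.sum_congr rfl fun y _ => ?_
          rw [Finset.mul_sum]
          refine Finset.sum_congr rfl fun z hz => ?_
          rw [(Finset.mem_filter.1 hz).2]
      _ ≤ ∑ y ∈ I.image g, PY y * 1 := by
          refine Finset.sum_le_sum fun y _ =>
            mul_le_mul_of_nonneg_left (hsum _ y ?_ ?_) (pushforward_nonneg hw _ _)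
          · intro z hz
            obtain ⟨ω, _, h⟩ := Finset.mem_image.1 (Finset.mem_filter.1 hz).1
            exact ⟨ω, h⟩
          · exact fun z hz => (Finset.mem_filter.1 hz).2
      _ = ∑ ω, w ω := by
          rw [sum_pushforward_mul_of_mem _ _ hJ (fun _ => 1)]
          simp
  have hlog2 : 0 < Real.log 2 := Real.log_pos one_lt_two
  have term : ∀ ω, w ω * (Real.logb 2 (PY (g (Z ω))) + Real.logb 2 (q (Z ω))
      - Real.logb 2 (PZ (Z ω))) ≤ w ω * (PY (g (Z ω)) * q (Z ω) / PZ (Z ω) - 1) / Real.log 2 := by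
    intro ω
    rcases (hw ω).eq_or_lt with h | h
    · rw [← h]; simp
    · have h1 : 0 < PY (g (Z ω)) := h.trans_le (le_pushforward hw (fun ω => g (Z ω)) ω)
      have h2 : 0 < PZ (Z ω) := h.trans_le (le_pushforward hw Z ω)
      have h3 := hpos ω h
      have hl : Real.logb 2 (PY (g (Z ω))) + Real.logb 2 (q (Z ω)) - Real.logb 2 (PZ (Z ω))
          = Real.log (PY (g (Z ω)) * q (Z ω) / PZ (Z ω)) / Real.log 2 := by
        rw [Real.log_div (by positivity) h2.ne', Real.log_mul h1.ne' h3.ne']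
        simp only [Real.logb]
        ring
      rw [hl, mul_div_assoc (w ω)]
      refine mul_le_mul_of_nonneg_left ?_ h.le
      refine div_le_div_of_nonneg_right ?_ hlog2.le
      exact Real.log_le_sub_one_of_pos (by positivity)
  have hle : ∑ ω, w ω * (PY (g (Z ω)) * q (Z ω) / PZ (Z ω) - 1) / Real.log 2 ≤ 0 := by
    rw [← Finset.sum_div]
    refine div_nonpos_of_nonpos_of_nonneg ?_ hlog2.le
    simp only [mul_sub, Finset.sum_sub_distrib, mul_one]
    linarith
  have htot := (Finset.sum_le_sum fun ω (_ : ω ∈ Finset.univ) => term ω).trans hle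
  simp only [mul_sub, mul_add, Finset.sum_sub_distrib, Finset.sum_add_distrib] at htot
  simp only [entropy]
  linarith

lemma entropy_comp_le (hw : 0 ≤ w) (f : Ω → S) (g : S → T) :
    entropy w (fun ω => g (f ω)) ≤ entropy w f := by
  refine neg_le_neg (Finset.sum_le_sum fun ω _ => ?_)
  rcases (hw ω).eq_or_lt with h | h
  · rw [← h]; simp
  · exact mul_le_mul_of_nonneg_left (Real.logb_le_logb_of_le one_lt_two
      (h.trans_le (le_pushforward hw f ω)) (pushforward_le_of_factor hw f g ω)) h.le

lemma sum_pushforward_le (hw : 0 ≤ w) (f : Ω → S) (s : Finset S) :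
    ∑ y ∈ s, pushforward w f y ≤ ∑ ω, w ω := by
  classical
  have := sum_pushforward_mul_of_mem (w := w) f (s ∪ Finset.univ.image f)
    (fun ω => Finset.mem_union_right _ (Finset.mem_image_of_mem _ (Finset.mem_univ _)))
    (fun _ => 1)
  simp only [mul_one] at this
  rw [← this]
  exact Finset.sum_le_sum_of_subset_of_nonneg Finset.subset_union_left
    fun _ _ _ => pushforward_nonneg hw _ _

/-- Gibbs with the unconditional law of `g` in place of its conditional law given `f`. -/
lemma entropy_pair_le (hw : 0 ≤ w) (hw1 : ∑ ω, w ω = 1) (f : Ω → S) (g : Ω → T) :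
    entropy w (fun ω => (f ω, g ω)) ≤ entropy w f + entropy w g := by
  classical
  have h := entropy_sub_entropy_le hw (fun ω => (f ω, g ω)) Prod.fst
    (fun z => pushforward w g z.2) (fun z => pushforward_nonneg hw _ _)
    (fun ω hω => hω.trans_le (le_pushforward hw g ω)) (by
      intro s y _ hs
      rw [← Finset.sum_image (f := pushforward w g) (g := Prod.snd) (s := s)]
      · exact (sum_pushforward_le hw g _).trans hw1.le
      · intro a ha b hb hab
        exact Prod.ext ((hs a ha).trans (hs b hb).symm) hab)
  simp only at h
  have : entropy w g = -∑ ω, w ω * Real.logb 2 (pushforward w g (g ω)) := rfl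
  linarith

/-- The data processing inequality, for a function of the output. -/
lemma noiseInformation_comp_le {α : Type*} [Fintype α] {p : α → ℝ} (hp : 0 ≤ p) (hw : 0 ≤ w)
    (f : α → Ω → S) (g : S → T) :
    noiseInformation p w (fun x ω => g (f x ω)) ≤ noiseInformation p w f := by
  classical
  set J := prodWeight p w
  have hJ : 0 ≤ J := fun z => mul_nonneg (hp _) (hw _)
  set PZ := pushforward J (fun z => f z.1 z.2) with hPZ
  set PY := pushforward J (fun z => g (f z.1 z.2)) with hPY
  have hfib : ∀ (s : Finset S) (y : T), (∀ z ∈ s, g z = y) →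
      ∑ z ∈ s, PZ z ≤ PY y := by
    intro s y hs
    simp only [hPZ, hPY, pushforward]
    rw [Finset.sum_comm]
    refine Finset.sum_le_sum fun ω _ => ?_
    rw [Finset.sum_ite_eq]
    split_ifs with h1 h2
    · exact le_rfl
    · exact absurd (hs _ h1) h2
    · exact hJ ω
    · exact le_rfl
  -- For each input, Gibbs is applied with the conditional law of the finer output given the coarser
  -- one under the averaged input. Averaging over `x` turns the right side into exactly the
  -- difference of the two output entropies.
  have hx : ∀ x, p x * (entropy w (f x) - entropy w (fun ω => g (f x ω))) ≤
      p x * -∑ ω, w ω * Real.logb 2 (PZ (f x ω) / PY (g (f x ω))) := by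
    intro x
    rcases (hp x).eq_or_lt with h | h
    · rw [← h]; simp
    · refine mul_le_mul_of_nonneg_left ?_ h.le
      refine entropy_sub_entropy_le hw (f x) g (fun z => PZ z / PY (g z)) (fun z => ?_) ?_ ?_
      · exact div_nonneg (pushforward_nonneg hJ _ _) (pushforward_nonneg hJ _ _)
      · intro ω hω
        have hpos : 0 < J (x, ω) := mul_pos h hω
        exact div_pos (hpos.trans_le (le_pushforward hJ (fun z => f z.1 z.2) (x, ω)))
          (hpos.trans_le (le_pushforward hJ (fun z => g (f z.1 z.2)) (x, ω)))
      · intro s y _ hs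
        have : ∑ z ∈ s, PZ z / PY (g z) = (∑ z ∈ s, PZ z) / PY y := by
          rw [Finset.sum_div]
          exact Finset.sum_congr rfl fun z hz => by rw [hs z hz]
        rw [this]
        exact div_le_one_of_le₀ (hfib s y hs) (pushforward_nonneg hJ _ _)
  have hsum := Finset.sum_le_sum fun x (_ : x ∈ Finset.univ) => hx x
  have hR : ∑ x, p x * -∑ ω, w ω * Real.logb 2 (PZ (f x ω) / PY (g (f x ω))) =
      entropy J (fun z => f z.1 z.2) - entropy J (fun z => g (f z.1 z.2)) := by
    simp only [entropy]
    rw [neg_sub_neg, ← Finset.sum_sub_distrib, Fintype.sum_prod_type]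
    refine Finset.sum_congr rfl fun x _ => ?_
    rw [← Finset.sum_neg_distrib, Finset.mul_sum]
    refine Finset.sum_congr rfl fun ω _ => ?_
    rcases (hJ (x, ω)).eq_or_lt with h | h
    · have h' : p x * w ω = 0 := h.symm
      rw [← h, mul_neg, ← mul_assoc, h']
      simp
    · have h1 := h.trans_le (le_pushforward hJ (fun z => f z.1 z.2) (x, ω))
      have h2 := h.trans_le (le_pushforward hJ (fun z => g (f z.1 z.2)) (x, ω))
      rw [Real.logb_div h1.ne' h2.ne']
      simp only [J, prodWeight]
      ring
  rw [hR] at hsum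
  simp only [mul_sub, Finset.sum_sub_distrib] at hsum
  simp only [noiseInformation]
  linarith

lemma entropy_const (hw1 : ∑ ω, w ω = 1) (c : S) : entropy w (fun _ => c) = 0 := by
  simp [entropy, pushforward, hw1]

end Entropy

/-! ### Mutual information of channels with independent noise -/

section Information

variable {α α' κ κ' ι β γ : Type*} [Fintype α] [Fintype α'] [Fintype κ] [Fintype κ'] [Fintype ι]
  {p : α → ℝ} {w : κ → ℝ}

lemma prodWeight_nonneg {α κ : Type*} {p : α → ℝ} {w : κ → ℝ} (hp : 0 ≤ p) (hw : 0 ≤ w) : 0 ≤ prodWeight p w :=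
  fun _ => mul_nonneg (hp _) (hw _)

lemma sum_prodWeight (hp : ∑ x, p x = 1) (hw : ∑ k, w k = 1) : ∑ z, prodWeight p w z = 1 := by
  simp only [prodWeight, Fintype.sum_prod_type]
  rw [← Finset.sum_mul_sum, hp, hw, mul_one]

lemma noiseInformation_nonneg (hp : 0 ≤ p) (hp1 : ∑ x, p x = 1) (hw : 0 ≤ w)
    (hw1 : ∑ k, w k = 1) (f : α → κ → β) : 0 ≤ noiseInformation p w f := by
  have h := noiseInformation_comp_le hp hw f (fun _ => ())
  have h0 : noiseInformation p w (fun (_ : α) (_ : κ) => ()) = 0 := by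
    simp [noiseInformation, entropy_const (sum_prodWeight hp1 hw1), entropy_const hw1]
  exact h0.symm.le.trans h

/-- Changing the underlying input and noise spaces. -/
lemma noiseInformation_map (p : α → ℝ) (w : κ → ℝ) (σ : α → α') (π : κ → κ') (f : α' → κ' → β) :
    noiseInformation p w (fun x k => f (σ x) (π k)) =
      noiseInformation (pushforward p σ) (pushforward w π) f := by
  classical
  have hprod : prodWeight (pushforward p σ) (pushforward w π) =
      pushforward (prodWeight p w) (fun z => (σ z.1, π z.2)) := by
    funext z
    simp only [prodWeight, pushforward, Fintype.sum_prod_type, Finset.sum_mul_sum, Prod.ext_iff]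
    refine Finset.sum_congr rfl fun x _ => Finset.sum_congr rfl fun k _ => ?_
    by_cases h1 : σ x = z.1 <;> by_cases h2 : π k = z.2 <;> simp [h1, h2]
  simp only [noiseInformation]
  rw [hprod, entropy_pushforward, sum_pushforward_mul]
  congr 1
  exact Finset.sum_congr rfl fun x _ => by rw [entropy_pushforward]

lemma pushforward_id (w : κ → ℝ) : pushforward w (fun k => k) = w := by
  classical
  funext k
  simp [pushforward]

lemma pushforward_fst {v : κ' → ℝ} (hv : ∑ k, v k = 1) (w : κ → ℝ) :
    pushforward (prodWeight w v) Prod.fst = w := by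
  classical
  funext k
  simp only [pushforward, prodWeight, Fintype.sum_prod_type]
  rw [Finset.sum_eq_single k]
  · simp [← Finset.mul_sum, hv]
  · intro b _ hb
    simp [hb]
  · simp

lemma pushforward_snd (hw : ∑ k, w k = 1) (v : κ' → ℝ) :
    pushforward (prodWeight w v) Prod.snd = v := by
  classical
  funext k
  simp only [pushforward, prodWeight, Fintype.sum_prod_type]
  simp [← Finset.sum_mul, hw]

/-- Independent random variables have additive entropy. -/
lemma entropy_prodWeight {v : κ' → ℝ} (hw : 0 ≤ w) (hw1 : ∑ k, w k = 1) (hv : 0 ≤ v)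
    (hv1 : ∑ k, v k = 1) (f : κ → β) (g : κ' → γ) :
    entropy (prodWeight w v) (fun z => (f z.1, g z.2)) = entropy w f + entropy v g := by
  classical
  have hP : ∀ a b, pushforward (prodWeight w v) (fun z => (f z.1, g z.2)) (a, b) =
      pushforward w f a * pushforward v g b := by
    intro a b
    simp only [prodWeight, pushforward, Fintype.sum_prod_type, Finset.sum_mul_sum, Prod.ext_iff]
    refine Finset.sum_congr rfl fun x _ => Finset.sum_congr rfl fun k _ => ?_
    by_cases h1 : f x = a <;> by_cases h2 : g k = b <;> simp [h1, h2]
  have hterm : ∀ z : κ × κ', prodWeight w v z * Real.logb 2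
      (pushforward (prodWeight w v) (fun z => (f z.1, g z.2)) (f z.1, g z.2)) =
      w z.1 * Real.logb 2 (pushforward w f (f z.1)) * v z.2 +
        w z.1 * (v z.2 * Real.logb 2 (pushforward v g (g z.2))) := by
    intro z
    rw [hP]
    simp only [prodWeight]
    rcases (hw z.1).eq_or_lt with h1 | h1
    · simp only [Pi.zero_apply] at h1
      simp [← h1]
    rcases (hv z.2).eq_or_lt with h2 | h2
    · simp only [Pi.zero_apply] at h2
      simp [← h2]
    rw [Real.logb_mul (h1.trans_le (le_pushforward hw f _)).ne'
      (h2.trans_le (le_pushforward hv g _)).ne']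
    ring
  simp only [entropy]
  rw [Finset.sum_congr rfl fun z _ => hterm z, Finset.sum_add_distrib]
  simp only [Fintype.sum_prod_type]
  rw [← Finset.sum_mul_sum, ← Finset.sum_mul_sum, hw1, hv1]
  ring

/-- For two channels with independent noise, used on possibly dependent inputs, the mutual
information is at most the sum of the two mutual informations. -/
lemma noiseInformation_prod_le {v : κ' → ℝ} (hp : 0 ≤ p) (hp1 : ∑ x, p x = 1) (hw : 0 ≤ w)
    (hw1 : ∑ k, w k = 1) (hv : 0 ≤ v) (hv1 : ∑ k, v k = 1) (f : α → κ → β) (g : α → κ' → γ) :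
    noiseInformation p (prodWeight w v) (fun x z => (f x z.1, g x z.2)) ≤
      noiseInformation p w f + noiseInformation p v g := by
  have hwv := prodWeight_nonneg hw hv
  have hwv1 := sum_prodWeight hw1 hv1
  have hf : noiseInformation p w f =
      noiseInformation p (prodWeight w v) (fun x z => f x z.1) := by
    have := noiseInformation_map p (prodWeight w v) (fun x => x) Prod.fst f
    rw [this, pushforward_id, pushforward_fst hv1]
  have hg : noiseInformation p v g =
      noiseInformation p (prodWeight w v) (fun x z => g x z.2) := by
    have := noiseInformation_map p (prodWeight w v) (fun x => x) Prod.snd g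
    rw [this, pushforward_id, pushforward_snd hw1]
  have hx : ∀ x, entropy (prodWeight w v) (fun z => (f x z.1, g x z.2)) =
      entropy (prodWeight w v) (fun z => f x z.1) + entropy (prodWeight w v) (fun z => g x z.2) := by
    intro x
    have e1 := entropy_pushforward (w := prodWeight w v) Prod.fst (f x)
    have e2 := entropy_pushforward (w := prodWeight w v) Prod.snd (g x)
    rw [pushforward_fst hv1] at e1
    rw [pushforward_snd hw1] at e2
    rw [entropy_prodWeight hw hw1 hv hv1, e1, e2]
  have h := entropy_pair_le (prodWeight_nonneg hp hwv) (sum_prodWeight hp1 hwv1)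
    (fun z => f z.1 z.2.1) (fun z => g z.1 z.2.2)
  rw [hf, hg]
  simp only [noiseInformation, hx, mul_add, Finset.sum_add_distrib]
  linarith

/-- The chain rule for a component of the noise that is part of the output. -/
lemma entropy_mixture {P : ι → ℝ} {v : ι → κ → ℝ} (hP : 0 ≤ P) (hv : ∀ a, 0 ≤ v a)
    (hv1 : ∀ a, ∑ k, v a k = 1) (f : ι → κ → β) :
    entropy (fun z : ι × κ => P z.1 * v z.1 z.2) (fun z => (z.1, f z.1 z.2)) =
      entropy P (fun a => a) + ∑ a, P a * entropy (v a) (f a) := by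
  classical
  have hpush : ∀ a b, pushforward (fun z : ι × κ => P z.1 * v z.1 z.2)
      (fun z => (z.1, f z.1 z.2)) (a, b) = P a * pushforward (v a) (f a) b := by
    intro a b
    simp only [pushforward, Fintype.sum_prod_type, Prod.ext_iff]
    rw [Finset.sum_eq_single a]
    · simp [Finset.mul_sum]
    · intro c _ hc
      simp [hc]
    · simp
  simp only [entropy, pushforward_id, Fintype.sum_prod_type]
  rw [← Finset.sum_neg_distrib, ← Finset.sum_neg_distrib, ← Finset.sum_add_distrib]
  refine Finset.sum_congr rfl fun a _ => ?_
  have hterm : ∀ k, P a * v a k * Real.logb 2 (pushforward (fun z : ι × κ => P z.1 * v z.1 z.2)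
      (fun z => (z.1, f z.1 z.2)) (a, f a k)) = P a * Real.logb 2 (P a) * v a k +
      P a * (v a k * Real.logb 2 (pushforward (v a) (f a) (f a k))) := by
    intro k
    rw [hpush]
    rcases (hP a).eq_or_lt with h1 | h1
    · simp only [Pi.zero_apply] at h1
      simp [← h1]
    rcases (hv a k).eq_or_lt with h2 | h2
    · simp only [Pi.zero_apply] at h2
      simp [← h2]
    rw [Real.logb_mul h1.ne' (h2.trans_le (le_pushforward (hv a) (f a) k)).ne']
    ring
  rw [Finset.sum_congr rfl fun k _ => hterm k, Finset.sum_add_distrib, ← Finset.mul_sum,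
    ← Finset.mul_sum, hv1]
  ring

/-- The revealed component is independent of the input, so its entropy enters both the output
entropy and the conditional entropy, and cancels. -/
lemma noiseInformation_mixture {P : ι → ℝ} {v : ι → κ → ℝ} (hp : 0 ≤ p) (hp1 : ∑ x, p x = 1)
    (hP : 0 ≤ P) (hv : ∀ a, 0 ≤ v a) (hv1 : ∀ a, ∑ k, v a k = 1) (f : α → ι → κ → β) :
    noiseInformation p (fun z : ι × κ => P z.1 * v z.1 z.2) (fun x z => (z.1, f x z.1 z.2)) =
      ∑ a, P a * noiseInformation p (v a) (fun x k => f x a k) := by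
  have h1 : entropy (prodWeight p fun z : ι × κ => P z.1 * v z.1 z.2)
      (fun z => (z.2.1, f z.1 z.2.1 z.2.2)) =
      entropy (fun z : ι × (α × κ) => P z.1 * prodWeight p (v z.1) z.2)
        (fun z => (z.1, f z.2.1 z.1 z.2.2)) := by
    let e : ι × (α × κ) ≃ α × (ι × κ) :=
      { toFun := fun z => (z.2.1, z.1, z.2.2)
        invFun := fun z => (z.2.1, z.1, z.2.2)
        left_inv := fun _ => rfl
        right_inv := fun _ => rfl }
    have hw : pushforward (fun z : ι × (α × κ) => P z.1 * prodWeight p (v z.1) z.2) e =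
        prodWeight p fun z : ι × κ => P z.1 * v z.1 z.2 := by
      classical
      funext z
      simp only [pushforward, ← Equiv.eq_symm_apply, Finset.sum_ite_eq', Finset.mem_univ, if_true]
      simp only [prodWeight, e, Equiv.coe_fn_symm_mk]
      ring
    rw [← hw, entropy_pushforward]
    rfl
  have h2 := entropy_mixture (κ := α × κ) hP (fun a => prodWeight_nonneg hp (hv a))
    (fun a => sum_prodWeight hp1 (hv1 a)) (fun a (z : α × κ) => f z.1 a z.2)
  simp only [noiseInformation]
  rw [h1, h2]
  simp only [entropy_mixture hP hv hv1, mul_add, mul_sub, Finset.sum_add_distrib,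
    Finset.sum_sub_distrib, ← Finset.sum_mul, hp1, Finset.mul_sum]
  rw [Finset.sum_comm (s := (Finset.univ : Finset ι)) (t := (Finset.univ : Finset α))]
  simp only [one_mul, mul_left_comm]
  ring

/-- This is I(X;Y) = H(Y) - H(Y|X). The logarithm of the quotient splits only at positive weight;
the remaining terms vanish. -/
lemma mutualInformation_eq_noiseInformation [Fintype β] (hp : 0 ≤ p) (hw : 0 ≤ w)
    (f : α → κ → β) :
    mutualInformation p (fun x y => pushforward w (f x) y) = noiseInformation p w f := by
  classical
  have hQ : ∀ y, ∑ x, p x * pushforward w (f x) y =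
      pushforward (prodWeight p w) (fun z => f z.1 z.2) y := by
    intro y
    simp [pushforward, Fintype.sum_prod_type, prodWeight, Finset.mul_sum]
  simp only [mutualInformation, noiseInformation, hQ, entropy, mul_assoc]
  rw [Fintype.sum_prod_type, ← Finset.sum_neg_distrib, ← Finset.sum_sub_distrib]
  refine Finset.sum_congr rfl fun x _ => ?_
  rw [← Finset.mul_sum, sum_pushforward_mul]
  simp only [prodWeight, mul_neg, Finset.mul_sum]
  rw [← Finset.sum_neg_distrib, ← Finset.sum_neg_distrib, ← Finset.sum_sub_distrib]
  refine Finset.sum_congr rfl fun k _ => ?_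
  rcases (hp x).eq_or_lt with h1 | h1
  · simp only [Pi.zero_apply] at h1
    simp [← h1]
  rcases (hw k).eq_or_lt with h2 | h2
  · simp only [Pi.zero_apply] at h2
    simp [← h2]
  have h3 : 0 < pushforward (prodWeight p w) (fun z => f z.1 z.2) (f x k) :=
    (mul_pos h1 h2).trans_le
      (le_pushforward (prodWeight_nonneg hp hw) (fun z : α × κ => f z.1 z.2) (x, k))
  rw [Real.logb_div (h2.trans_le (le_pushforward hw (f x) k)).ne' h3.ne']
  ring

/-- A bound on the mutual information that does not depend on the input distribution. -/
lemma noiseInformation_le_logb_card (hp : 0 ≤ p) (hp1 : ∑ x, p x = 1) (hw : 0 ≤ w)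
    [Fintype β] [Nonempty β] (hw1 : ∑ k, w k = 1) (f : α → κ → β) :
    noiseInformation p w f ≤ Real.logb 2 (Fintype.card β) := by
  have hcard : (0 : ℝ) < Fintype.card β := by exact_mod_cast Fintype.card_pos
  have hJ := prodWeight_nonneg hp hw
  have hJ1 := sum_prodWeight hp1 hw1
  -- Gibbs against the uniform distribution on the output alphabet.
  have h := entropy_sub_entropy_le hJ (fun z => f z.1 z.2) (fun _ => ())
    (fun _ => (Fintype.card β : ℝ)⁻¹) (fun _ => by positivity) (fun _ _ => by positivity) (by
      intro s _ _ _
      rw [Finset.sum_const, nsmul_eq_mul, ← div_eq_mul_inv]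
      exact div_le_one_of_le₀ (by exact_mod_cast Finset.card_le_univ s) hcard.le)
  rw [entropy_const hJ1, ← Finset.sum_mul, hJ1, Real.logb_inv] at h
  have h0 : 0 ≤ ∑ x, p x * entropy w (f x) := Finset.sum_nonneg fun x _ =>
    mul_nonneg (hp x) ((entropy_const hw1 ()).symm.le.trans
      (entropy_comp_le hw (f x) (fun _ => ())))
  simp only [noiseInformation]
  linarith

end Information

/-! ### Random sets of surviving positions -/

section SurvivalWeight

variable {ι : Type*} [Fintype ι] [DecidableEq ι]

/-- The probability that `K` is exactly the set of survivors when the element `i` is deleted with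
probability `δ i`, independently of the others. -/
def survivalWeight (δ : ι → ℝ) (K : Finset ι) : ℝ := ∏ i, if i ∈ K then 1 - δ i else δ i

lemma sum_prod_ite_mem (a b : ι → ℝ) :
    ∑ K : Finset ι, ∏ i, (if i ∈ K then a i else b i) = ∏ i, (a i + b i) := by
  rw [Fintype.prod_add]
  refine Finset.sum_congr rfl fun K _ => ?_
  rw [Finset.prod_ite]
  congr 1
  · exact Finset.prod_congr (by ext; simp) fun _ _ => rfl
  · exact Finset.prod_congr (by ext; simp) fun _ _ => rfl

lemma survivalWeight_nonneg {δ : ι → ℝ} (hδ : ∀ i, δ i ∈ Set.Icc (0 : ℝ) 1) :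
    0 ≤ survivalWeight δ := fun K => Finset.prod_nonneg fun i _ => by
  split_ifs
  · exact sub_nonneg.2 (hδ i).2
  · exact (hδ i).1

lemma sum_survivalWeight (δ : ι → ℝ) : ∑ K, survivalWeight δ K = 1 := by
  simp [survivalWeight, sum_prod_ite_mem]

lemma survivalWeight_const (d : ℝ) (K : Finset ι) :
    survivalWeight (fun _ => d) K = (1 - d) ^ K.card * d ^ (Fintype.card ι - K.card) := by
  rw [survivalWeight, Finset.prod_ite, Finset.prod_const, Finset.prod_const,
    ← Finset.card_compl K]
  congr 3
  · ext; simp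
  · ext; simp

/-- Linearity of expectation: `i` survives with probability `1 - δ i`. -/
lemma sum_survivalWeight_mul_sum (δ c : ι → ℝ) :
    ∑ K, survivalWeight δ K * ∑ i ∈ K, c i = ∑ i, (1 - δ i) * c i := by
  have h : ∀ j, ∑ K, (if j ∈ K then survivalWeight δ K else 0) = 1 - δ j := by
    intro j
    -- Replacing the deletion factor at `j` by 0 encodes the event `j ∈ K` and keeps the product
    -- form.
    have hK : ∀ K : Finset ι, (if j ∈ K then survivalWeight δ K else 0) =
        ∏ i, if i ∈ K then 1 - δ i else (if i = j then 0 else δ i) := by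
      intro K
      split_ifs with hj
      · refine Finset.prod_congr rfl fun i _ => ?_
        by_cases hi : i ∈ K
        · simp [hi]
        · have : i ≠ j := fun e => hi (e ▸ hj)
          simp [hi, this]
      · exact (Finset.prod_eq_zero (Finset.mem_univ j) (by simp [hj])).symm
    rw [Finset.sum_congr rfl fun K _ => hK K, sum_prod_ite_mem, Finset.prod_eq_single j]
    · simp
    · intro i _ hi
      simp [hi]
    · simp
  have h2 : ∀ K : Finset ι, survivalWeight δ K * ∑ i ∈ K, c i =
      ∑ i, (if i ∈ K then survivalWeight δ K else 0) * c i := by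
    intro K
    rw [Finset.mul_sum, ← Finset.sum_filter_add_sum_filter_not Finset.univ (· ∈ K)]
    rw [Finset.sum_eq_zero (s := Finset.univ.filter fun i => i ∉ K), add_zero]
    · refine Finset.sum_congr (by ext; simp) fun i hi => ?_
      rw [if_pos (by simpa using hi)]
    · intro i hi
      rw [if_neg (by simpa using hi), zero_mul]
  rw [Finset.sum_congr rfl fun K _ => h2 K, Finset.sum_comm]
  exact Finset.sum_congr rfl fun i _ => by rw [← Finset.sum_mul, h]

lemma survivalWeight_pos_imp {δ : ι → ℝ} {K : Finset ι} (h : 0 < survivalWeight δ K) {i : ι}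
    (hi : i ∈ K) : 1 - δ i ≠ 0 := by
  have := Finset.prod_ne_zero_iff.1 h.ne' i (Finset.mem_univ i)
  rwa [if_pos hi] at this

/-- A random choice between two deletion probabilities averages them. -/
lemma pushforward_mixed_survivalWeight (t d₁ d₂ : ℝ) :
    pushforward (fun z : Finset ι × Finset ι => survivalWeight (fun _ => 1 - t) z.1 *
      survivalWeight (fun i => if i ∈ z.1 then d₁ else d₂) z.2) Prod.snd =
      survivalWeight fun _ => t * d₁ + (1 - t) * d₂ := by
  classical
  funext K
  simp only [pushforward, Fintype.sum_prod_type, Finset.sum_ite_eq', Finset.mem_univ, if_true]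
  have : ∀ A : Finset ι, survivalWeight (fun _ => 1 - t) A *
      survivalWeight (fun i => if i ∈ A then d₁ else d₂) K =
      ∏ i, if i ∈ A then t * (if i ∈ K then 1 - d₁ else d₁)
        else (1 - t) * (if i ∈ K then 1 - d₂ else d₂) := by
    intro A
    rw [survivalWeight, survivalWeight, ← Finset.prod_mul_distrib]
    refine Finset.prod_congr rfl fun i _ => ?_
    by_cases hA : i ∈ A <;> by_cases hK : i ∈ K <;> simp [hA, hK]
  rw [Finset.sum_congr rfl fun A _ => this A, sum_prod_ite_mem]
  refine Finset.prod_congr rfl fun i _ => ?_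
  split_ifs <;> ring

end SurvivalWeight

/-! ### Splitting and merging words -/

section Split

variable {m n N : ℕ}

/-- The union of a set of positions in the first block and one in the second block. -/
def joinSubsets (e : Fin m ⊕ Fin n ≃ Fin N) :
    Finset (Fin m) × Finset (Fin n) ≃ Finset (Fin N) :=
  Finset.sumEquiv.symm.toEquiv.trans e.finsetCongr

lemma inl_mem_joinSubsets (e : Fin m ⊕ Fin n ≃ Fin N) (z : Finset (Fin m) × Finset (Fin n))
    (i : Fin m) : e (Sum.inl i) ∈ joinSubsets e z ↔ i ∈ z.1 := by
  simp [joinSubsets, Finset.sumEquiv]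

lemma inr_mem_joinSubsets (e : Fin m ⊕ Fin n ≃ Fin N) (z : Finset (Fin m) × Finset (Fin n))
    (i : Fin n) : e (Sum.inr i) ∈ joinSubsets e z ↔ i ∈ z.2 := by
  simp [joinSubsets, Finset.sumEquiv]

/-- Survival in disjoint blocks is independent. -/
lemma pushforward_joinSubsets (e : Fin m ⊕ Fin n ≃ Fin N) (δ : Fin N → ℝ) :
    pushforward (prodWeight (survivalWeight fun i => δ (e (Sum.inl i)))
      (survivalWeight fun i => δ (e (Sum.inr i)))) (joinSubsets e) = survivalWeight δ := by
  classical
  funext K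
  simp only [pushforward, ← Equiv.eq_symm_apply, Finset.sum_ite_eq', Finset.mem_univ, if_true]
  obtain ⟨z, rfl⟩ := (joinSubsets e).surjective K
  rw [Equiv.symm_apply_apply]
  simp only [prodWeight, survivalWeight]
  rw [← e.prod_comp, Fintype.prod_sum_type]
  simp only [inl_mem_joinSubsets, inr_mem_joinSubsets]

/-- The subsequence of `x` at the positions in `K`. -/
def survivors {β : Type*} (x : Fin N → β) (K : Finset (Fin N)) : List β :=
  ((List.finRange N).filter (fun i => decide (i ∈ K))).map x

/-- A monotone reindexing keeps the order: both position lists are strictly increasing with the same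
members. -/
lemma survivors_comp {β : Type*} (x : Fin N → β) (φ : Fin m → Fin N) (hφ : StrictMono φ)
    (k : Finset (Fin m)) (K : Finset (Fin N)) (hK : ∀ j, j ∈ K ↔ ∃ i ∈ k, φ i = j) :
    survivors (fun i => x (φ i)) k = survivors x K := by
  have h : ((List.finRange m).filter (fun i => decide (i ∈ k))).map φ =
      (List.finRange N).filter (fun i => decide (i ∈ K)) := by
    refine List.SortedLT.eq_of_mem_iff ?_ ?_ ?_
    · refine List.Pairwise.sortedLT (List.Pairwise.map _ (fun a b h => hφ h)
        ((List.pairwise_lt_finRange m).filter _))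
    · exact ((List.pairwise_lt_finRange N).filter _).sortedLT
    · intro j
      simp [hK]
  rw [survivors, survivors, ← h, List.map_map]
  rfl

lemma survivors_joinSubsets_append (x : Fin (m + n) → Bool)
    (z : Finset (Fin m) × Finset (Fin n)) :
    survivors x (joinSubsets finSumFinEquiv z) =
      survivors (fun i => x (finSumFinEquiv (Sum.inl i))) z.1 ++
        survivors (fun i => x (finSumFinEquiv (Sum.inr i))) z.2 := by
  have h : (List.finRange (m + n)).filter
        (fun i => decide (i ∈ joinSubsets finSumFinEquiv z)) =
      ((List.finRange m).filter (fun i => decide (i ∈ z.1))).map (Fin.castAdd n) ++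
        ((List.finRange n).filter (fun i => decide (i ∈ z.2))).map (Fin.natAdd m) := by
    refine List.SortedLT.eq_of_mem_iff ((List.pairwise_lt_finRange _).filter _).sortedLT ?_ ?_
    · refine List.Pairwise.sortedLT (List.pairwise_append.2 ⟨?_, ?_, ?_⟩)
      · exact List.Pairwise.map _ (fun a b h => h) ((List.pairwise_lt_finRange m).filter _)
      · exact List.Pairwise.map _ (fun a b h => by simpa using h)
          ((List.pairwise_lt_finRange n).filter _)
      · intro a ha b hb
        obtain ⟨i, _, rfl⟩ := List.mem_map.1 ha
        obtain ⟨j, _, rfl⟩ := List.mem_map.1 hb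
        simp only [Fin.lt_def, Fin.val_castAdd, Fin.val_natAdd]
        omega
    · intro j
      obtain ⟨s, rfl⟩ := finSumFinEquiv.surjective j
      rcases s with i | i
      · have := inl_mem_joinSubsets finSumFinEquiv z i
        rw [finSumFinEquiv_apply_left] at this
        simp only [List.mem_filter, List.mem_finRange, true_and, decide_eq_true_eq, this,
          List.mem_append, List.mem_map, finSumFinEquiv_apply_left]
        constructor
        · exact fun h => Or.inl ⟨i, h, rfl⟩
        · rintro (⟨a, ha, h⟩ | ⟨a, ha, h⟩)
          · exact (Fin.castAdd_injective m n h) ▸ ha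
          · simp only [Fin.ext_iff, Fin.val_castAdd, Fin.val_natAdd] at h
            omega
      · have := inr_mem_joinSubsets finSumFinEquiv z i
        rw [finSumFinEquiv_apply_right] at this
        simp only [List.mem_filter, List.mem_finRange, true_and, decide_eq_true_eq, this,
          List.mem_append, List.mem_map, finSumFinEquiv_apply_right]
        constructor
        · exact fun h => Or.inr ⟨i, h, rfl⟩
        · rintro (⟨a, ha, h⟩ | ⟨a, ha, h⟩)
          · simp only [Fin.ext_iff, Fin.val_castAdd, Fin.val_natAdd] at h
            omega
          · exact (Fin.natAdd_injective n m h) ▸ ha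
  rw [survivors, h, List.map_append, List.map_map, List.map_map]
  rfl

/-- Interleaves two lists, taking the next element from the first list at each `true` label and
from the second list at each `false` label. -/
def interleave {β : Type*} : List Bool → List β → List β → List β
  | true :: F, a :: l₁, l₂ => a :: interleave F l₁ l₂
  | false :: F, l₁, a :: l₂ => a :: interleave F l₁ l₂
  -- Covers exhausted labels as well as labels that do not fit the lists; words split by their own
  -- labels only meet the former.
  | _, _, _ => []

lemma interleave_filter {ι β : Type*} (l : List ι) (c : ι → Bool) (x : ι → β) :
    interleave (l.map c) ((l.filter c).map x) ((l.filter fun i => !c i).map x) = l.map x := by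
  induction l with
  | nil => rfl
  | cons a l ih => cases h : c a <;> simp [h, interleave, ih]

lemma survivors_inter (x : Fin N → Bool) (A K : Finset (Fin N)) :
    survivors x (K ∩ A) =
      (((List.finRange N).filter (fun i => decide (i ∈ K))).filter
        (fun i => decide (i ∈ A))).map x := by
  rw [survivors, List.filter_filter]
  congr 2
  funext i
  by_cases h1 : i ∈ A <;> by_cases h2 : i ∈ K <;> simp [h1, h2]

lemma interleave_survivors (x : Fin N → Bool) (A K : Finset (Fin N)) :
    interleave (survivors (fun i => decide (i ∈ A)) K) (survivors x (K ∩ A))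
      (survivors x (K ∩ Aᶜ)) = survivors x K := by
  rw [survivors_inter, survivors_inter]
  have := interleave_filter ((List.finRange N).filter (fun i => decide (i ∈ K)))
    (fun i => decide (i ∈ A)) x
  simpa [survivors] using this

lemma length_survivors {β : Type*} (x : Fin N → β) (K : Finset (Fin N)) :
    (survivors x K).length = K.card := by
  rw [survivors, List.length_map, ← List.toFinset_card_of_nodup
    ((List.nodup_finRange N).filter _)]
  congr 1
  ext; simp

lemma prod_map_survivors {β : Type*} (x : Fin N → β) (K : Finset (Fin N)) (r : β → ℝ) :
    ((survivors x K).map r).prod = ∏ i ∈ K, r (x i) := by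
  rw [survivors, List.map_map, ← List.prod_toFinset _ ((List.nodup_finRange N).filter _)]
  exact Finset.prod_congr (by ext; simp) fun _ _ => rfl

/-- The weights are those of i.i.d. labels, and those of all words of length `L` sum to `(r true + r
false) ^ L`. Fixing the length is essential, since every length may contribute total weight 1. -/
lemma sum_prod_map_le_one (r : Bool → ℝ) (hr : 0 ≤ r) (h1 : r true + r false ≤ 1) (L : ℕ)
    (s : Finset (List Bool)) (hs : ∀ l ∈ s, l.length = L) :
    ∑ l ∈ s, (l.map r).prod ≤ 1 := by
  have hsub : s ⊆ Finset.univ.image (List.ofFn : (Fin L → Bool) → List Bool) := by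
    intro l hl
    obtain rfl := hs l hl
    exact Finset.mem_image.2 ⟨l.get, Finset.mem_univ _, List.ofFn_get l⟩
  calc ∑ l ∈ s, (l.map r).prod
      ≤ ∑ l ∈ Finset.univ.image (List.ofFn : (Fin L → Bool) → List Bool), (l.map r).prod :=
        Finset.sum_le_sum_of_subset_of_nonneg hsub fun l _ _ =>
          List.prod_nonneg fun a ha => by
            obtain ⟨b, _, rfl⟩ := List.mem_map.1 ha
            exact hr b
    _ = ∑ g : Fin L → Bool, ∏ i, r (g i) := by
        rw [Finset.sum_image fun _ _ _ _ h => List.ofFn_injective h]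
        exact Finset.sum_congr rfl fun g _ => by rw [List.map_ofFn, List.prod_ofFn]; rfl
    _ = (∑ b, r b) ^ L := (Fintype.sum_pow r L).symm
    _ ≤ 1 := pow_le_one₀ (Finset.sum_nonneg fun b _ => hr b) (by simpa using h1)

end Split

/-! ### Deletion channels on blocks -/

section Deletion

variable {m n N : ℕ} {d d₁ d₂ : ℝ}

lemma deletionChannel_eq_pushforward (d : ℝ) (N : ℕ) (x : Fin N → Bool) (y : ReceivedWord N) :
    deletionChannel d N x y = pushforward (survivalWeight fun _ => d) (received x) y := by
  classical
  rw [deletionChannel, pushforward, Finset.sum_filter]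
  refine Finset.sum_congr rfl fun K _ => ?_
  rw [survivalWeight_const, Fintype.card_fin]
  split_ifs <;> rfl

lemma mutualInformation_deletionChannel {p : (Fin N → Bool) → ℝ} (hd : d ∈ Set.Icc (0 : ℝ) 1)
    (hp : 0 ≤ p) :
    mutualInformation p (deletionChannel d N) =
      noiseInformation p (survivalWeight fun _ => d) received := by
  have h : deletionChannel d N =
      fun x y => pushforward (survivalWeight fun _ => d) (received x) y :=
    funext fun x => funext fun y => deletionChannel_eq_pushforward d N x y
  rw [h]
  exact mutualInformation_eq_noiseInformation hp (survivalWeight_nonneg fun _ => hd) received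

instance (N : ℕ) : Nonempty (ReceivedWord N) := ⟨⟨[], Nat.zero_le _⟩⟩

lemma noiseInformation_received_le {p : (Fin N → Bool) → ℝ} (hd : d ∈ Set.Icc (0 : ℝ) 1)
    (hp : p ∈ stdSimplex ℝ (Fin N → Bool)) :
    noiseInformation p (survivalWeight fun _ => d) received ≤ maxInformation d N := by
  -- The supremum is meaningful only for a bounded set; the alphabet size bounds it uniformly in the
  -- input law.
  refine le_csSup ⟨Real.logb 2 (Fintype.card (ReceivedWord N)), ?_⟩
    ⟨p, hp, mutualInformation_deletionChannel hd hp.1⟩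
  rintro _ ⟨p, hp, rfl⟩
  dsimp only
  rw [mutualInformation_deletionChannel hd hp.1]
  exact noiseInformation_le_logb_card hp.1 hp.2 (survivalWeight_nonneg fun _ => hd)
    (sum_survivalWeight _) received

/-- Plain lists free the output type from `N`, so that outputs of blocks of different lengths can be
combined. Together with `maxInformation_le` this shows that nothing is lost. -/
lemma noiseInformation_survivors_le {p : (Fin N → Bool) → ℝ} (hd : d ∈ Set.Icc (0 : ℝ) 1)
    (hp : p ∈ stdSimplex ℝ (Fin N → Bool)) :
    noiseInformation p (survivalWeight fun _ => d) survivors ≤ maxInformation d N :=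
  (noiseInformation_comp_le hp.1 (survivalWeight_nonneg fun _ => hd) received
    Subtype.val).trans (noiseInformation_received_le hd hp)

lemma maxInformation_le {B : ℝ} (hd : d ∈ Set.Icc (0 : ℝ) 1)
    (h : ∀ p ∈ stdSimplex ℝ (Fin N → Bool),
      noiseInformation p (survivalWeight fun _ => d) survivors ≤ B) :
    maxInformation d N ≤ B := by
  refine csSup_le ?_ ?_
  · exact Set.Nonempty.image _ ⟨_, single_mem_stdSimplex ℝ fun _ => false⟩
  · rintro _ ⟨p, hp, rfl⟩
    dsimp only
    rw [mutualInformation_deletionChannel hd hp.1]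
    refine le_trans (le_of_eq_of_le ?_ (noiseInformation_comp_le hp.1
      (survivalWeight_nonneg fun _ => hd) survivors
      -- The default word is never used: an actual output has length at most `N`.
      (fun l => if h : l.length ≤ N then (⟨l, h⟩ : ReceivedWord N) else ⟨[], Nat.zero_le _⟩)))
      (h p hp)
    congr 1
    funext x K
    exact (dif_pos (received x K).2).symm

lemma maxInformation_nonneg (hd : d ∈ Set.Icc (0 : ℝ) 1) : 0 ≤ maxInformation d N := by
  have hp := single_mem_stdSimplex ℝ fun _ : Fin N => false
  exact (noiseInformation_nonneg hp.1 hp.2 (survivalWeight_nonneg fun _ => hd)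
    (sum_survivalWeight _) received).trans (noiseInformation_received_le hd hp)

lemma pushforward_mem_stdSimplex {α β : Type*} [Fintype α] [Fintype β] {p : α → ℝ}
    (hp : p ∈ stdSimplex ℝ α) (σ : α → β) : pushforward p σ ∈ stdSimplex ℝ β := by
  refine ⟨fun y => pushforward_nonneg hp.1 σ y, ?_⟩
  have := sum_pushforward_mul (w := p) σ (fun _ => 1)
  simpa [hp.2] using this

/-- Two deletion channels used on two disjoint blocks of the input. -/
lemma noiseInformation_blocks_le (hd₁ : d₁ ∈ Set.Icc (0 : ℝ) 1) (hd₂ : d₂ ∈ Set.Icc (0 : ℝ) 1)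
    {p : (Fin N → Bool) → ℝ} (hp : p ∈ stdSimplex ℝ (Fin N → Bool)) (φ : Fin m → Fin N)
    (ψ : Fin n → Fin N) :
    noiseInformation p (prodWeight (survivalWeight fun _ => d₁) (survivalWeight fun _ => d₂))
      (fun x z => (survivors (fun i => x (φ i)) z.1, survivors (fun i => x (ψ i)) z.2)) ≤
      maxInformation d₁ m + maxInformation d₂ n := by
  refine (noiseInformation_prod_le hp.1 hp.2 (survivalWeight_nonneg fun _ => hd₁)
    (sum_survivalWeight _) (survivalWeight_nonneg fun _ => hd₂) (sum_survivalWeight _)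
    (fun x k => survivors (fun i => x (φ i)) k) (fun x k => survivors (fun i => x (ψ i)) k)).trans
    (add_le_add ?_ ?_)
  · rw [noiseInformation_map p _ (fun (x : Fin N → Bool) i => x (φ i)) (fun k => k) survivors,
      pushforward_id]
    exact noiseInformation_survivors_le hd₁ (pushforward_mem_stdSimplex hp _)
  · rw [noiseInformation_map p _ (fun (x : Fin N → Bool) i => x (ψ i)) (fun k => k) survivors,
      pushforward_id]
    exact noiseInformation_survivors_le hd₂ (pushforward_mem_stdSimplex hp _)

/-- Cut the input into its first `m` and last `n` bits. A receiver given the two block outputs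
separately can concatenate them, so it has at least as much information. -/
lemma subadditive_maxInformation (hd : d ∈ Set.Icc (0 : ℝ) 1) :
    Subadditive (maxInformation d) := by
  intro m n
  refine maxInformation_le hd fun p hp => ?_
  have hw := prodWeight_nonneg (survivalWeight_nonneg (ι := Fin m) fun _ => hd)
    (survivalWeight_nonneg (ι := Fin n) fun _ => hd)
  have h := noiseInformation_comp_le hp.1 hw
    (fun x z => (survivors (fun i => x (finSumFinEquiv (Sum.inl i))) z.1,
      survivors (fun i => x (finSumFinEquiv (Sum.inr i))) z.2)) (fun y => y.1 ++ y.2)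
  refine le_trans (le_of_eq ?_) (h.trans (noiseInformation_blocks_le hd hd hp _ _))
  have hmap := noiseInformation_map p (prodWeight (survivalWeight fun _ => d)
    (survivalWeight fun _ => d)) (fun x => x) (joinSubsets (finSumFinEquiv (m := m) (n := n)))
    survivors
  rw [pushforward_id, pushforward_joinSubsets finSumFinEquiv (fun _ => d)] at hmap
  rw [← hmap]
  congr 1
  funext x z
  exact survivors_joinSubsets_append x z

/-- The survivors inside `A` and outside `A`, for a fixed set `A` of positions. -/
lemma noiseInformation_split_le (hd₁ : d₁ ∈ Set.Icc (0 : ℝ) 1) (hd₂ : d₂ ∈ Set.Icc (0 : ℝ) 1)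
    {p : (Fin N → Bool) → ℝ} (hp : p ∈ stdSimplex ℝ (Fin N → Bool)) (A : Finset (Fin N)) :
    noiseInformation p (survivalWeight fun i => if i ∈ A then d₁ else d₂)
      (fun x K => (survivors x (K ∩ A), survivors x (K ∩ Aᶜ))) ≤
      maxInformation d₁ A.card + maxInformation d₂ Aᶜ.card := by
  -- Enumerates `A` and its complement, each increasingly, so that the survivors in each block keep
  -- their order.
  set e := finSumEquivOfFinset (s := A) rfl rfl
  have hl : ∀ i, e (Sum.inl i) = A.orderEmbOfFin rfl i := finSumEquivOfFinset_inl rfl rfl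
  have hr : ∀ i, e (Sum.inr i) = Aᶜ.orderEmbOfFin rfl i := finSumEquivOfFinset_inr rfl rfl
  have hlA : ∀ i, e (Sum.inl i) ∈ A := fun i => hl i ▸ Finset.orderEmbOfFin_mem A rfl i
  have hrA : ∀ i, e (Sum.inr i) ∉ A := fun i =>
    Finset.mem_compl.1 (hr i ▸ Finset.orderEmbOfFin_mem Aᶜ rfl i)
  have hpush := pushforward_joinSubsets e (fun i => if i ∈ A then d₁ else d₂)
  simp only [hlA, hrA, if_true, if_false] at hpush
  have hmap := noiseInformation_map p (prodWeight (survivalWeight fun _ => d₁)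
    (survivalWeight fun _ => d₂)) (fun x => x) (joinSubsets e)
    (fun (x : Fin N → Bool) K => (survivors x (K ∩ A), survivors x (K ∩ Aᶜ)))
  rw [pushforward_id, hpush] at hmap
  rw [← hmap]
  refine le_of_eq_of_le ?_ (noiseInformation_blocks_le hd₁ hd₂ hp (fun i => e (Sum.inl i))
    (fun i => e (Sum.inr i)))
  congr 1
  funext x z
  refine Prod.ext ?_ ?_
  · refine (survivors_comp x (fun i => e (Sum.inl i)) ?_ z.1 _ ?_).symm
    · intro a b hab
      simpa only [hl] using (A.orderEmbOfFin rfl).strictMono hab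
    · intro j
      obtain ⟨s, rfl⟩ := e.surjective j
      rcases s with i | i
      · simp [hlA, inl_mem_joinSubsets]
      · simp [hrA]
  · refine (survivors_comp x (fun i => e (Sum.inr i)) ?_ z.2 _ ?_).symm
    · intro a b hab
      simpa only [hr] using (Aᶜ.orderEmbOfFin rfl).strictMono hab
    · intro j
      obtain ⟨s, rfl⟩ := e.surjective j
      rcases s with i | i
      · simp [hlA]
      · simp [hrA, inr_mem_joinSubsets]

end Deletion

/-! ### Cost of the labels and the finite-length bound -/

section Labels

variable {N : ℕ} {t d₁ d₂ : ℝ}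

lemma mixedWeight_nonneg (ht : t ∈ Set.Icc (0 : ℝ) 1) (hd₁ : d₁ ∈ Set.Icc (0 : ℝ) 1)
    (hd₂ : d₂ ∈ Set.Icc (0 : ℝ) 1) :
    0 ≤ (fun z : Finset (Fin N) × Finset (Fin N) => survivalWeight (fun _ => 1 - t) z.1 *
      survivalWeight (fun i => if i ∈ z.1 then d₁ else d₂) z.2) := fun z =>
  mul_nonneg
    (survivalWeight_nonneg (fun _ => ⟨sub_nonneg.2 ht.2, sub_le_self _ ht.1⟩) _)
    (survivalWeight_nonneg (fun i => by split_ifs <;> assumption) _)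

/-- A position is routed to the first channel and survives with probability `t * (1 - d₁)`, and
similarly for the second; `u` and `v` will be the logarithmic costs of the two labels. -/
lemma sum_mixedWeight_mul_sum (t d₁ d₂ u v : ℝ) :
    ∑ z : Finset (Fin N) × Finset (Fin N), (survivalWeight (fun _ => 1 - t) z.1 *
      survivalWeight (fun i => if i ∈ z.1 then d₁ else d₂) z.2) *
        ∑ i ∈ z.2, (if i ∈ z.1 then u else v) =
      N * (t * (1 - d₁) * u + (1 - t) * (1 - d₂) * v) := by
  rw [Fintype.sum_prod_type]
  have h : ∀ A : Finset (Fin N), ∑ K, (survivalWeight (fun _ => 1 - t) A *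
      survivalWeight (fun i => if i ∈ A then d₁ else d₂) K) *
        ∑ i ∈ K, (if i ∈ A then u else v) =
      survivalWeight (fun _ => 1 - t) A * ∑ i ∈ A, ((1 - d₁) * u - (1 - d₂) * v) +
        survivalWeight (fun _ => 1 - t) A * (N * ((1 - d₂) * v)) := by
    intro A
    simp only [mul_assoc, ← Finset.mul_sum]
    rw [sum_survivalWeight_mul_sum, ← mul_add]
    congr 1
    have : ∀ i : Fin N, (1 - if i ∈ A then d₁ else d₂) * (if i ∈ A then u else v) =
        (if i ∈ A then (1 - d₁) * u - (1 - d₂) * v else 0) + (1 - d₂) * v := by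
      intro i
      split_ifs <;> ring
    rw [Finset.sum_congr rfl fun i _ => this i, Finset.sum_add_distrib]
    simp
  simp only [h]
  rw [Finset.sum_add_distrib, sum_survivalWeight_mul_sum]
  simp only [← Finset.sum_mul, sum_survivalWeight, sub_sub_cancel, Finset.sum_const,
    Finset.card_univ, Fintype.card_fin, nsmul_eq_mul]
  ring

lemma sum_survivalWeight_mul_card (t : ℝ) :
    ∑ A : Finset (Fin N), survivalWeight (fun _ => 1 - t) A * A.card = N * t := by
  have := sum_survivalWeight_mul_sum (fun _ : Fin N => 1 - t) (fun _ => 1)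
  simpa using this

/-- The cost of the labels that tell which channel delivered each received bit. -/
lemma entropy_labels_le {Ω : Type*} [Fintype Ω] {w : Ω → ℝ} (hw : 0 ≤ w)
    (x : Ω → Fin N → Bool) (A K : Ω → Finset (Fin N)) (r₁ r₂ : ℝ) (hr₁ : 0 ≤ r₁) (hr₂ : 0 ≤ r₂)
    (hr : r₁ + r₂ ≤ 1) (hpos : ∀ ω, 0 < w ω → ∀ i ∈ K ω, (if i ∈ A ω then r₁ else r₂) ≠ 0) :
    entropy w (fun ω => ((survivors (x ω) (K ω ∩ A ω), survivors (x ω) (K ω ∩ (A ω)ᶜ)),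
        survivors (fun i => decide (i ∈ A ω)) (K ω))) -
      entropy w (fun ω => (survivors (x ω) (K ω ∩ A ω), survivors (x ω) (K ω ∩ (A ω)ᶜ))) ≤
      -∑ ω, w ω * ∑ i ∈ K ω, (if i ∈ A ω then Real.logb 2 r₁ else Real.logb 2 r₂) := by
  set r : Bool → ℝ := fun b => if b then r₁ else r₂ with hrdef
  have hr0 : 0 ≤ r := fun b => by cases b <;> simpa [hrdef]
  have hq : ∀ ω, ((survivors (fun i => decide (i ∈ A ω)) (K ω)).map r).prod =
      ∏ i ∈ K ω, (if i ∈ A ω then r₁ else r₂) := fun ω => by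
    rw [prod_map_survivors]
    simp [hrdef]
  have h := entropy_sub_entropy_le hw
    (fun ω => ((survivors (x ω) (K ω ∩ A ω), survivors (x ω) (K ω ∩ (A ω)ᶜ)),
        survivors (fun i => decide (i ∈ A ω)) (K ω))) Prod.fst (fun z => (z.2.map r).prod)
    (fun z => List.prod_nonneg fun a ha => by
      obtain ⟨b, _, rfl⟩ := List.mem_map.1 ha
      exact hr0 b)
    (fun ω hω => by
      simp only [hq]
      refine Finset.prod_pos fun i hi => lt_of_le_of_ne ?_ (hpos ω hω i hi).symm
      split_ifs <;> assumption)
    (by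
      intro s y hs hy
      rw [← Finset.sum_image (f := fun l : List Bool => (l.map r).prod) (g := Prod.snd) (s := s)]
      -- Once both outputs are fixed, the number of labels is the sum of their lengths.
      · refine sum_prod_map_le_one r hr0 (by simpa [hrdef] using hr) (y.1.length + y.2.length) _ ?_
        intro l hl
        obtain ⟨z, hz, rfl⟩ := Finset.mem_image.1 hl
        obtain ⟨ω, rfl⟩ := hs z hz
        rw [← hy _ hz]
        simp only [length_survivors]
        rw [← Finset.sdiff_eq_inter_compl, Finset.card_inter_add_card_sdiff]
      · intro a ha b hb hab
        exact Prod.ext ((hy a ha).trans (hy b hb).symm) hab)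
  refine h.trans (le_of_eq ?_)
  congr 1
  refine Finset.sum_congr rfl fun ω _ => ?_
  rcases (hw ω).eq_or_lt with h0 | h0
  · simp only [Pi.zero_apply] at h0
    rw [← h0, zero_mul, zero_mul]
  · simp only [hq]
    rw [Real.logb_prod _ _ (hpos ω h0)]
    congr 1
    refine Finset.sum_congr rfl fun i _ => ?_
    split_ifs <;> rfl

/-- The finite-length form of the inequality. -/
lemma maxInformation_mix_le (ht : t ∈ Set.Icc (0 : ℝ) 1) (hd₁ : d₁ ∈ Set.Icc (0 : ℝ) 1)
    (hd₂ : d₂ ∈ Set.Icc (0 : ℝ) 1) (N : ℕ) {r₁ r₂ : ℝ} (hr₁ : 0 ≤ r₁) (hr₂ : 0 ≤ r₂)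
    (hr : r₁ + r₂ ≤ 1) (h₁ : t * (1 - d₁) ≠ 0 → r₁ ≠ 0) (h₂ : (1 - t) * (1 - d₂) ≠ 0 → r₂ ≠ 0) :
    maxInformation (t * d₁ + (1 - t) * d₂) N ≤
      ∑ A : Finset (Fin N), survivalWeight (fun _ => 1 - t) A *
        (maxInformation d₁ A.card + maxInformation d₂ Aᶜ.card) +
      N * (-(t * (1 - d₁) * Real.logb 2 r₁) - (1 - t) * (1 - d₂) * Real.logb 2 r₂) := by
  have hd : t * d₁ + (1 - t) * d₂ ∈ Set.Icc (0 : ℝ) 1 :=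
    (convex_Icc (0 : ℝ) 1) hd₁ hd₂ ht.1 (sub_nonneg.2 ht.2) (by ring)
  have ht' : ∀ _ : Fin N, 1 - t ∈ Set.Icc (0 : ℝ) 1 :=
    fun _ => ⟨sub_nonneg.2 ht.2, sub_le_self _ ht.1⟩
  have hδ : ∀ (A : Finset (Fin N)) i, (if i ∈ A then d₁ else d₂) ∈ Set.Icc (0 : ℝ) 1 :=
    fun A i => by split_ifs <;> assumption
  refine maxInformation_le hd fun p hp => ?_
  -- `z.1` is the set routed to the first channel, drawn as a survival set with deletion probability
  -- `1 - t`; `z.2` is the set of survivors.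
  set W := fun z : Finset (Fin N) × Finset (Fin N) => survivalWeight (fun _ => 1 - t) z.1 *
      survivalWeight (fun i => if i ∈ z.1 then d₁ else d₂) z.2 with hW
  have hW0 : 0 ≤ W := mixedWeight_nonneg ht hd₁ hd₂
  set Y : (Fin N → Bool) → Finset (Fin N) × Finset (Fin N) → List Bool × List Bool :=
    fun x z => (survivors x (z.2 ∩ z.1), survivors x (z.2 ∩ z.1ᶜ)) with hY
  set Z : (Fin N → Bool) → Finset (Fin N) × Finset (Fin N) →
      (List Bool × List Bool) × List Bool :=
    fun x z => (Y x z, survivors (fun i => decide (i ∈ z.1)) z.2) with hZ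
  have step1 : noiseInformation p (survivalWeight fun _ => t * d₁ + (1 - t) * d₂) survivors ≤
      noiseInformation p W Z := by
    have h := noiseInformation_comp_le hp.1 hW0 Z (fun z => interleave z.2 z.1.1 z.1.2)
    refine le_of_eq_of_le ?_ h
    rw [← pushforward_mixed_survivalWeight]
    have hmap := noiseInformation_map p W (fun x => x) Prod.snd survivors
    rw [pushforward_id] at hmap
    rw [← hmap]
    congr 1
    funext x z
    exact (interleave_survivors x z.1 z.2).symm
  have step2 : noiseInformation p W Z ≤ noiseInformation p W Y +
      N * (-(t * (1 - d₁) * Real.logb 2 r₁) - (1 - t) * (1 - d₂) * Real.logb 2 r₂) := by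
    have hpos : ∀ z, 0 < W z → ∀ i ∈ z.2, (if i ∈ z.1 then r₁ else r₂) ≠ 0 := by
      intro z hz i hi
      have hA := pos_of_mul_pos_left hz (survivalWeight_nonneg (hδ z.1) z.2)
      have hK := pos_of_mul_pos_right hz (survivalWeight_nonneg ht' z.1)
      have hKi := survivalWeight_pos_imp hK hi
      have hAi := Finset.prod_ne_zero_iff.1 hA.ne' i (Finset.mem_univ i)
      split_ifs at hKi hAi ⊢ with hiA
      · exact h₁ (mul_ne_zero (by simpa using hAi) hKi)
      · exact h₂ (mul_ne_zero hAi hKi)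
    have hl := entropy_labels_le (prodWeight_nonneg hp.1 hW0) (fun z => z.1) (fun z => z.2.1)
      (fun z => z.2.2) r₁ r₂ hr₁ hr₂ hr
      (fun z hz => hpos z.2 (pos_of_mul_pos_right hz (hp.1 z.1)))
    have hE : ∑ z, prodWeight p W z *
        ∑ i ∈ z.2.2, (if i ∈ z.2.1 then Real.logb 2 r₁ else Real.logb 2 r₂) =
        N * (t * (1 - d₁) * Real.logb 2 r₁ + (1 - t) * (1 - d₂) * Real.logb 2 r₂) := by
      rw [Fintype.sum_prod_type]
      have hx : ∀ x, ∑ z, prodWeight p W (x, z) *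
          ∑ i ∈ z.2, (if i ∈ z.1 then Real.logb 2 r₁ else Real.logb 2 r₂) = p x *
          (N * (t * (1 - d₁) * Real.logb 2 r₁ + (1 - t) * (1 - d₂) * Real.logb 2 r₂)) := by
        intro x
        rw [← sum_mixedWeight_mul_sum, Finset.mul_sum]
        exact Finset.sum_congr rfl fun z _ => mul_assoc _ _ _
      rw [Finset.sum_congr rfl fun x _ => hx x, ← Finset.sum_mul, hp.2, one_mul]
    rw [hE] at hl
    -- Dropping the labels can only lower the conditional entropy given the input, so the gain in
    -- information is at most the gain in output entropy.
    have hx : ∑ x, p x * entropy W (Y x) ≤ ∑ x, p x * entropy W (Z x) :=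
      Finset.sum_le_sum fun x _ => mul_le_mul_of_nonneg_left
        (entropy_comp_le hW0 (Z x) Prod.fst) (hp.1 x)
    simp only [noiseInformation]
    simp only [hZ, hY] at hx ⊢
    linarith
  have step3 : noiseInformation p W Y ≤ ∑ A : Finset (Fin N),
      survivalWeight (fun _ => 1 - t) A *
        (maxInformation d₁ A.card + maxInformation d₂ Aᶜ.card) := by
    -- Reveal the routing set to the receiver, then condition on it.
    have h := noiseInformation_comp_le hp.1 hW0 (fun x z => (z.1, Y x z)) Prod.snd
    have hmix := noiseInformation_mixture hp.1 hp.2 (survivalWeight_nonneg ht')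
      (fun A => survivalWeight_nonneg (hδ A)) (fun A => sum_survivalWeight _)
      (fun x A K => Y x (A, K))
    refine h.trans (hmix.le.trans ?_)
    exact Finset.sum_le_sum fun A _ => mul_le_mul_of_nonneg_left
      (noiseInformation_split_le hd₁ hd₂ hp A) (survivalWeight_nonneg ht' A)
  linarith

end Labels

/-! ### Passage to the limit -/

section Capacity

variable {d : ℝ}

/-- Fekete's lemma for a subadditive sequence, with nonnegativity as the lower bound. -/
lemma tendsto_deletionCapacity (hd : d ∈ Set.Icc (0 : ℝ) 1) :
    Tendsto (fun N : ℕ => maxInformation d N / N) atTop (𝓝 (deletionCapacity d)) := by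
  have h := (subadditive_maxInformation hd).tendsto_lim ⟨0, by
    rintro _ ⟨N, rfl⟩
    exact div_nonneg (maxInformation_nonneg hd) N.cast_nonneg⟩
  rwa [deletionCapacity, h.limUnder_eq]

/-- The maximal information exceeds the linear function with slope slightly above the capacity by
at most a constant. -/
lemma exists_maxInformation_le (hd : d ∈ Set.Icc (0 : ℝ) 1) {ε : ℝ} (hε : 0 < ε) :
    ∃ B, ∀ n : ℕ, maxInformation d n ≤ n * (deletionCapacity d + ε) + B := by
  have h := (tendsto_deletionCapacity hd).eventually_lt_const (lt_add_of_pos_right _ hε)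
  have h2 : ∀ᶠ n : ℕ in atTop,
      maxInformation d n - n * (deletionCapacity d + ε) ≤ 0 := by
    filter_upwards [h, eventually_gt_atTop 0] with n hn hn0
    rw [div_lt_iff₀ (by exact_mod_cast hn0)] at hn
    linarith
  obtain ⟨B, hB⟩ := (isBoundedUnder_of_eventually_le h2).bddAbove_range
  exact ⟨B, fun n => by linarith [hB (Set.mem_range_self n)]⟩

/-- The block lengths are random, so the capacities enter through the affine bounds of
`exists_maxInformation_le`, valid for every length. Their expectation needs only the mean `N * t` of
the first length, and the constants vanish after division by `N`. -/
lemma deletionCapacity_mix_le {t d₁ d₂ r₁ r₂ : ℝ} (ht : t ∈ Set.Icc (0 : ℝ) 1)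
    (hd₁ : d₁ ∈ Set.Icc (0 : ℝ) 1) (hd₂ : d₂ ∈ Set.Icc (0 : ℝ) 1) (hr₁ : 0 ≤ r₁) (hr₂ : 0 ≤ r₂)
    (hr : r₁ + r₂ ≤ 1) (h₁ : t * (1 - d₁) ≠ 0 → r₁ ≠ 0) (h₂ : (1 - t) * (1 - d₂) ≠ 0 → r₂ ≠ 0) :
    deletionCapacity (t * d₁ + (1 - t) * d₂) ≤
      t * deletionCapacity d₁ + (1 - t) * deletionCapacity d₂ +
        (-(t * (1 - d₁) * Real.logb 2 r₁) - (1 - t) * (1 - d₂) * Real.logb 2 r₂) := by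
  have hd : t * d₁ + (1 - t) * d₂ ∈ Set.Icc (0 : ℝ) 1 :=
    (convex_Icc (0 : ℝ) 1) hd₁ hd₂ ht.1 (sub_nonneg.2 ht.2) (by ring)
  set G := -(t * (1 - d₁) * Real.logb 2 r₁) - (1 - t) * (1 - d₂) * Real.logb 2 r₂ with hG
  refine le_of_forall_pos_le_add fun ε hε => ?_
  obtain ⟨B₁, hB₁⟩ := exists_maxInformation_le hd₁ hε
  obtain ⟨B₂, hB₂⟩ := exists_maxInformation_le hd₂ hε
  set L := t * (deletionCapacity d₁ + ε) + (1 - t) * (deletionCapacity d₂ + ε) + G with hL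
  have hbound : ∀ N : ℕ, maxInformation (t * d₁ + (1 - t) * d₂) N ≤ N * L + (B₁ + B₂) := by
    intro N
    refine (maxInformation_mix_le ht hd₁ hd₂ N hr₁ hr₂ hr h₁ h₂).trans ?_
    have hA : ∀ A : Finset (Fin N), survivalWeight (fun _ => 1 - t) A *
        (maxInformation d₁ A.card + maxInformation d₂ Aᶜ.card) ≤
        survivalWeight (fun _ => 1 - t) A * A.card *
            ((deletionCapacity d₁ + ε) - (deletionCapacity d₂ + ε)) +
          survivalWeight (fun _ => 1 - t) A * (N * (deletionCapacity d₂ + ε) + (B₁ + B₂)) := by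
      intro A
      have hc : (Aᶜ.card : ℝ) = N - A.card := by
        rw [Finset.card_compl, Fintype.card_fin, Nat.cast_sub (card_finset_fin_le A)]
      have e₁ := hB₁ A.card
      have e₂ := hB₂ Aᶜ.card
      rw [hc] at e₂
      rw [mul_assoc, ← mul_add]
      refine mul_le_mul_of_nonneg_left ?_
        (survivalWeight_nonneg (fun _ => ⟨sub_nonneg.2 ht.2, sub_le_self _ ht.1⟩) A)
      linarith
    have hsum := Finset.sum_le_sum fun A (_ : A ∈ Finset.univ) => hA A
    rw [Finset.sum_add_distrib, ← Finset.sum_mul, ← Finset.sum_mul, sum_survivalWeight_mul_card,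
      sum_survivalWeight] at hsum
    rw [hL]
    linarith
  have hlim : Tendsto (fun N : ℕ => L + (B₁ + B₂) / N) atTop (𝓝 (L + 0)) :=
    tendsto_const_nhds.add (tendsto_const_div_atTop_nhds_zero_nat _)
  have hle : deletionCapacity (t * d₁ + (1 - t) * d₂) ≤ L + 0 := by
    refine le_of_tendsto_of_tendsto (tendsto_deletionCapacity hd) hlim ?_
    filter_upwards [eventually_gt_atTop 0] with N hN
    have hN' : (0 : ℝ) < N := by exact_mod_cast hN
    rw [div_le_iff₀ hN', add_mul, div_mul_cancel₀ _ hN'.ne']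
    linarith [hbound N]
  rw [hL] at hle
  linarith

lemma mul_logb_div_add {a b : ℝ} (ha : 0 ≤ a) (hb : 0 ≤ b) :
    a * Real.logb 2 (a / (a + b)) = a * Real.logb 2 a - a * Real.logb 2 (a + b) := by
  rcases ha.eq_or_lt with rfl | ha
  · simp
  · rw [Real.logb_div ha.ne' (by positivity), mul_sub]

end Capacity

/-- The first part says that the limit defining the capacity exists for every deletion probability,
the second part is the inequality (with `0 * log 0 = 0`). -/
theorem theorem1 (d₁ d₂ lam d : ℝ) (hd₁ : d₁ ∈ Set.Icc (0 : ℝ) 1) (hd₂ : d₂ ∈ Set.Icc (0 : ℝ) 1)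
    (hlam : lam ∈ Set.Icc (0 : ℝ) 1) (hd : d = lam * d₁ + (1 - lam) * d₂) :
    (∀ δ ∈ Set.Icc (0 : ℝ) 1,
      Tendsto (fun N : ℕ => maxInformation δ N / N) atTop (𝓝 (deletionCapacity δ))) ∧
    deletionCapacity d ≤ lam * deletionCapacity d₁ + (1 - lam) * deletionCapacity d₂
      + (1 - d) * Real.logb 2 (1 - d)
      - lam * (1 - d₁) * Real.logb 2 (lam * (1 - d₁))
      - (1 - lam) * (1 - d₂) * Real.logb 2 ((1 - lam) * (1 - d₂)) := by
  refine ⟨fun δ hδ => tendsto_deletionCapacity hδ, ?_⟩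
  set a := lam * (1 - d₁) with ha
  set b := (1 - lam) * (1 - d₂) with hb
  have ha0 : 0 ≤ a := mul_nonneg hlam.1 (sub_nonneg.2 hd₁.2)
  have hb0 : 0 ≤ b := mul_nonneg (sub_nonneg.2 hlam.2) (sub_nonneg.2 hd₂.2)
  have hab : 1 - d = a + b := by rw [hd, ha, hb]; ring
  -- The label probabilities are the conditional probabilities of each channel given survival. If `a
  -- + b = 0`, both are 0 by the convention for division, and the nonvanishing conditions are
  -- vacuous.
  have h := deletionCapacity_mix_le (r₁ := a / (a + b)) (r₂ := b / (a + b)) hlam hd₁ hd₂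
    (by positivity) (by positivity) (by rw [← add_div]; exact div_self_le_one _)
    (fun h => div_ne_zero h (by positivity)) (fun h => div_ne_zero h (by positivity))
  rw [← ha, ← hb, mul_logb_div_add ha0 hb0, add_comm a b, mul_logb_div_add hb0 ha0,
    add_comm b a] at h
  rw [hab, hd]
  linarith
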